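/- Let $\mathbb I=[0,1]$ and let $\mathbb U$ be the monoid, under composition and ordered pointwise, of all monotone surjections $\mathbb I\to\mathbb I$. A $\mathbb U$-poset is a poset $A$ with an action of $\mathbb U$ that is monotone in both variables; morphisms of $\mathbb U$-posets are the $\mathbb U$-equivariant monotone maps. For $r\in\mathbb I$ and $a,b\in A$ write $a\le_r b$ if $u(a)\le v(b)$ for all $u,v\in\mathbb U$ such that $u(\min(1,t+r))\le v(t)$ for every $t\in\mathbb I$. Put $\rho(a,b)=\inf\{r\in\mathbb I: a\le_r b\}$ and $\mathrm{dist}(a,b)=\max(\rho(a,b),\rho(b,a))$. A $\mathbb U$-poset $A$ is complete if it is Archimedean, i.e. $a\le b$ whenever $a\le_r b$ for all $r>0$, and every $\mathrm{dist}$-Cauchy sequence in $A$ converges. It is stackable if, for all $0<r<1$ and all $u,v\in\mathbb U$ restricting to order isomorphisms $u:[0,r]\cong[0,1]$ and $v:[r,1]\cong[0,1]$: (1) for $a,b\in A$, $u(a)\le u(b)$ and $v(a)\le v(b)$ imply $a\le b$; (2) if $a,b\in A$ satisfy $v'(b)\le u'(a)$ for all $u',v'\in\mathbb U$, then there is $c\in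 A$ with $u(c)=a$ and $v(c)=b$. Let $\mathsf{CDLat}$ be the category of completely distributive lattices and maps preserving arbitrary joins and meets, and let $\mathsf{CSt}\mathbb U\mathsf{Pos}$ be the category of complete stackable $\mathbb U$-posets and $\mathbb U$-equivariant monotone maps. Theorem. For every completely distributive lattice $X$, the set $\mathsf{CDLat}(X,\mathbb I)$, with pointwise order and pointwise $\mathbb U$-action, is a complete stackable $\mathbb U$-poset. For every complete stackable $\mathbb U$-poset $A$, the set $\mathbb U\mathsf{Pos}(A,\mathbb I)$ of equivariant monotone maps, with pointwise order, is a completely distributive lattice. The resulting contravariant functors $\mathsf{CDLat}(-,\mathbb I)$ and $\mathbb U\mathsf{Pos}(-,\mathbb I)$, acting on morphisms by precomposition, form a dual equivalence of categories $$\mathsf{CDLat}^{\mathrm{op}}\simeq\mathsf{CSt}\mathbb U\mathsf{Pos},$$ whose unit and counit isomorphisms are given by the evaluation maps $X\to\mathbb U\mathsf{Pos}(\mathsf{CDLat}(X,\mathbb I),\mathbb I)$, $x\mapsto(f\mapsto f(x))$, and $A\to\mathsf{CDLat}(\mathbb U\mathsf{Pos}(A,\mathbb I),\mathbb I)$, $a\mapsto(f\mapsto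 f(a))$. -/

import Mathlib

open CategoryTheory Opposite

universe u

namespace UPosetDuality

/-- The monoid `U` of monotone surjections `[0,1] → [0,1]`, under composition and with the
pointwise order (both inherited from `unitInterval →o unitInterval`). -/
def U : Submonoid (unitInterval →o unitInterval) where
  carrier := {w | Function.Surjective w}
  mul_mem' := fun {_ _} hv hw => hv.comp hw
  one_mem' := Function.surjective_id

theorem U.mono (w : U) : Monotone (w : unitInterval →o unitInterval) := w.1.monotone

theorem U.map_sSup (w : U) (s : Set unitInterval) :
    w.1 (sSup s) = sSup (w.1 '' s) := by
  apply le_antisymm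
  · obtain ⟨t, ht⟩ := w.2 (sSup (w.1 '' s))
    rcases le_total (sSup s) t with h | h
    · exact (U.mono w h).trans ht.le
    · rcases h.eq_or_lt with h | h
      · rw [← h, ht]
      · obtain ⟨x, hx, hlt⟩ := lt_sSup_iff.1 h
        by_contra hcon
        rw [not_le] at hcon
        obtain ⟨y, hy1, hy2⟩ := exists_between hcon
        obtain ⟨q, rfl⟩ := w.2 y
        have hq : q < sSup s := by
          by_contra hq
          exact absurd (U.mono w (not_lt.1 hq)) (not_le.2 hy2)
        obtain ⟨z, hz, hqz⟩ := lt_sSup_iff.1 hq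
        exact absurd ((U.mono w hqz.le).trans (le_sSup (Set.mem_image_of_mem _ hz))) (not_le.2 hy1)
  · apply sSup_le
    rintro _ ⟨x, hx, rfl⟩
    exact U.mono w (le_sSup hx)

theorem U.map_sInf (w : U) (s : Set unitInterval) :
    w.1 (sInf s) = sInf (w.1 '' s) := by
  apply le_antisymm
  · apply le_sInf
    rintro _ ⟨x, hx, rfl⟩
    exact U.mono w (sInf_le hx)
  · by_contra hcon
    rw [not_le] at hcon
    obtain ⟨y, hy1, hy2⟩ := exists_between hcon
    obtain ⟨q, rfl⟩ := w.2 y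
    have hq : sInf s < q := by
      by_contra hq
      exact absurd (U.mono w (not_lt.1 hq)) (not_le.2 hy1)
    obtain ⟨z, hz, hqz⟩ := sInf_lt_iff.1 hq
    exact absurd ((sInf_le (Set.mem_image_of_mem _ hz)).trans (U.mono w hqz.le)) (not_le.2 hy2)

/-- Each `w : U` is a complete lattice homomorphism `[0,1] → [0,1]`. -/
noncomputable def U.toHom (w : U) : CompleteLatticeHom unitInterval unitInterval where
  toFun := w.1
  map_sInf' := U.map_sInf w
  map_sSup' := U.map_sSup w

/-- A `U`-poset: a poset with an action of `U`, monotone in both variables. -/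
class UPoset (A : Type*) extends PartialOrder A, MulAction U A where
  smul_mono : ∀ ⦃v w : U⦄ ⦃a b : A⦄, v ≤ w → a ≤ b → v • a ≤ w • b

/-- Equivariant monotone maps. -/
structure UPosetHom (A B : Type*) [UPoset A] [UPoset B] extends A →o B where
  map_smul' : ∀ (w : U) (a : A), toFun (w • a) = w • toFun a

namespace UPosetHom

variable {A B C : Type*} [UPoset A] [UPoset B] [UPoset C]

instance : FunLike (UPosetHom A B) A B where
  coe f := f.toFun
  coe_injective f g h := by
    rcases f with ⟨⟨f, _⟩, _⟩
    rcases g with ⟨⟨g, _⟩, _⟩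
    cases h
    rfl

theorem mono (f : UPosetHom A B) : Monotone f := f.monotone'

theorem map_smul (f : UPosetHom A B) (w : U) (a : A) : f (w • a) = w • f a := f.map_smul' w a

@[ext] theorem ext {f g : UPosetHom A B} (h : ∀ a, f a = g a) : f = g := DFunLike.ext _ _ h

/-- The identity. -/
def id (A : Type*) [UPoset A] : UPosetHom A A where
  toFun a := a
  monotone' _ _ h := h
  map_smul' _ _ := rfl

/-- Composition. -/
def comp (g : UPosetHom B C) (f : UPosetHom A B) : UPosetHom A C where
  toFun a := g (f a)
  monotone' _ _ h := g.mono (f.mono h)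
  map_smul' w a := by rw [map_smul, map_smul]

/-- The pointwise order. -/
instance : PartialOrder (UPosetHom A B) := PartialOrder.lift _ DFunLike.coe_injective

end UPosetHom

/-- The action of `U` on `[0,1]` by evaluation. -/
instance : UPoset unitInterval where
  smul w t := w.1 t
  one_smul _ := rfl
  mul_smul _ _ _ := rfl
  smul_mono _ w _ _ hvw hab := (hvw _).trans (U.mono w hab)

theorem smul_eq (w : U) (t : unitInterval) : w • t = w.1 t := rfl

/-! ### The metric structure, completeness and stackability -/

/-- Truncated addition `min 1 (s + r)` on `[0,1]`. -/
noncomputable def addT (s r : unitInterval) : unitInterval :=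
  ⟨min 1 ((s : ℝ) + r), le_min zero_le_one (add_nonneg s.2.1 r.2.1), min_le_left _ _⟩

section

variable {A : Type*} [UPoset A]

/-- The relation `a ≤_r b`. -/
def LeR (r : unitInterval) (a b : A) : Prop :=
  ∀ v w : U, (∀ t : unitInterval, v.1 (addT t r) ≤ w.1 t) → v • a ≤ w • b

/-- The canonical pseudoquasimetric (the infimum is taken in `[0,1]`). -/
noncomputable def rho (a b : A) : unitInterval := sInf {r | LeR r a b}

/-- The canonical pseudometric, the symmetrization of `rho`. -/
noncomputable def uDist (a b : A) : unitInterval := max (rho a b) (rho b a)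

variable (A)

/-- `A` is Archimedean. -/
def IsArchimedean : Prop :=
  ∀ a b : A, (∀ r : unitInterval, 0 < r → LeR r a b) → a ≤ b

/-- `A` is (Cauchy-)complete: Archimedean, and Cauchy sequences for `uDist` converge. -/
def IsCauchyComplete : Prop :=
  IsArchimedean A ∧
    ∀ s : ℕ → A,
      (∀ ε : unitInterval, 0 < ε → ∃ N, ∀ m ≥ N, ∀ n ≥ N, uDist (s m) (s n) < ε) →
      ∃ a : A, ∀ ε : unitInterval, 0 < ε → ∃ N, ∀ n ≥ N, uDist (s n) a < ε

/-- `w : U` restricts to an order isomorphism from `s` onto `[0,1]`. -/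
def RestrictsToIso (w : U) (s : Set unitInterval) : Prop :=
  ∃ e : s ≃o unitInterval, ∀ t : s, e t = w.1 t

/-- `A` is unstackable. -/
def IsUnstackable : Prop :=
  ∀ r : unitInterval, 0 < r → r < 1 → ∀ v w : U,
    RestrictsToIso v (Set.Icc 0 r) → RestrictsToIso w (Set.Icc r 1) →
    ∀ a b : A, v • a ≤ v • b → w • a ≤ w • b → a ≤ b

/-- `A` is stackable. -/
def IsStackable : Prop :=
  IsUnstackable A ∧
    ∀ r : unitInterval, 0 < r → r < 1 → ∀ v w : U,
      RestrictsToIso v (Set.Icc 0 r) → RestrictsToIso w (Set.Icc r 1) →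
      ∀ a b : A, (∀ v' w' : U, w' • b ≤ v' • a) → ∃ c : A, v • c = a ∧ w • c = b

end

/-! ### The categories -/

/-- The category of `U`-posets and equivariant monotone maps. -/
structure UPos where
  carrier : Type u
  [str : UPoset carrier]

instance : CoeSort UPos.{u} (Type u) := ⟨UPos.carrier⟩

instance (A : UPos.{u}) : UPoset A := A.str

instance : Category UPos.{u} where
  Hom A B := UPosetHom A B
  id A := UPosetHom.id A
  comp f g := g.comp f

instance : ConcreteCategory UPos.{u} (fun A B => UPosetHom A B) where
  hom f := f
  ofHom f := f

/-- The property of being a complete stackable `U`-poset. -/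
def isCompleteStackable : ObjectProperty UPos.{u} :=
  fun A => IsCauchyComplete A ∧ IsStackable A

/-- The category of complete stackable `U`-posets, full in `U`-posets. -/
abbrev CStUPos := (isCompleteStackable.{u}).FullSubcategory

/-- The property of being a completely distributive lattice: arbitrary meets distribute over
arbitrary joins. -/
def isCompletelyDistrib : ObjectProperty CompleteLat.{u} :=
  fun X => CompletelyDistribLattice.MinimalAxioms X

/-- The category of completely distributive lattices, with the maps preserving all joins and all
meets. -/
abbrev CDLat := (isCompletelyDistrib.{u}).FullSubcategory

/-! ### Hom into `[0,1]` -/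

/-- For a complete lattice `X`, the set of complete lattice homomorphisms `X → [0,1]`, with the
pointwise order and pointwise action of `U`. -/
noncomputable instance homUPoset (X : Type*) [CompleteLattice X] :
    UPoset (CompleteLatticeHom X unitInterval) where
  toPartialOrder := PartialOrder.lift _ DFunLike.coe_injective
  smul w f := (U.toHom w).comp f
  one_smul _ := rfl
  mul_smul _ _ _ := rfl
  smul_mono _ w f _ hvw hfg := fun x => (hvw (f x)).trans (U.mono w (hfg x))

theorem homUPoset_smul_apply {X : Type*} [CompleteLattice X] (w : U)
    (f : CompleteLatticeHom X unitInterval) (x : X) : (w • f) x = w.1 (f x) := rfl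

theorem homUPoset_le_iff {X : Type*} [CompleteLattice X]
    (f g : CompleteLatticeHom X unitInterval) : f ≤ g ↔ ∀ x, f x ≤ g x := Iff.rfl

/-- The contravariant functor `Hom(-, [0,1])` from complete lattices to `U`-posets, acting on
morphisms by precomposition. -/
noncomputable def homOfLat : CompleteLat.{u}ᵒᵖ ⥤ UPos.{u} where
  obj X := ⟨CompleteLatticeHom X.unop unitInterval⟩
  map {X Y} h :=
    ConcreteCategory.ofHom (C := UPos.{u})
      { toFun := fun f : CompleteLatticeHom X.unop unitInterval =>
          (f.comp (ConcreteCategory.hom h.unop) : CompleteLatticeHom Y.unop unitInterval)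
        monotone' := fun _ _ hfg _ => hfg _
        map_smul' := fun _ _ => rfl }
  map_id _ := rfl
  map_comp _ _ := rfl

section

variable (A : Type*) [UPoset A]

/-- Joins of equivariant monotone maps `A → [0,1]` are computed pointwise. -/
noncomputable instance : SupSet (UPosetHom A unitInterval) where
  sSup S :=
    { toFun := fun a => sSup ((fun f : UPosetHom A unitInterval => f a) '' S)
      monotone' := by
        intro a b hab
        apply sSup_le
        rintro _ ⟨f, hf, rfl⟩
        exact (f.mono hab).trans (le_sSup ⟨f, hf, rfl⟩)
      map_smul' := by
        intro w a
        rw [smul_eq, U.map_sSup, Set.image_image]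
        simp only [UPosetHom.map_smul, smul_eq] }

/-- Meets of equivariant monotone maps `A → [0,1]` are computed pointwise. -/
noncomputable instance : InfSet (UPosetHom A unitInterval) where
  sInf S :=
    { toFun := fun a => sInf ((fun f : UPosetHom A unitInterval => f a) '' S)
      monotone' := by
        intro a b hab
        apply le_sInf
        rintro _ ⟨f, hf, rfl⟩
        exact (sInf_le (Set.mem_image_of_mem _ hf)).trans (f.mono hab)
      map_smul' := by
        intro w a
        rw [smul_eq, U.map_sInf, Set.image_image]
        simp only [UPosetHom.map_smul, smul_eq] }

theorem isLUB_sSup_hom (S : Set (UPosetHom A unitInterval)) : IsLUB S (sSup S) :=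
  ⟨fun f hf _ => le_sSup ⟨f, hf, rfl⟩, fun g hg a => sSup_le (by
    rintro _ ⟨f, hf, rfl⟩
    exact hg hf a)⟩

theorem isGLB_sInf_hom (S : Set (UPosetHom A unitInterval)) : IsGLB S (sInf S) :=
  ⟨fun f hf _ => sInf_le ⟨f, hf, rfl⟩, fun g hg a => le_sInf (by
    rintro _ ⟨f, hf, rfl⟩
    exact hg hf a)⟩

/-- For a `U`-poset `A`, the set of equivariant monotone maps `A → [0,1]` is a complete lattice
under the pointwise order. -/
noncomputable instance homCompleteLattice : CompleteLattice (UPosetHom A unitInterval) where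
  sup f g := sSup {f, g}
  le_sup_left f g := (isLUB_sSup_hom A {f, g}).1 (by simp)
  le_sup_right f g := (isLUB_sSup_hom A {f, g}).1 (by simp)
  sup_le f g h hf hg := (isLUB_sSup_hom A {f, g}).2 (by simp [upperBounds, hf, hg])
  inf f g := sInf {f, g}
  inf_le_left f g := (isGLB_sInf_hom A {f, g}).1 (by simp)
  inf_le_right f g := (isGLB_sInf_hom A {f, g}).1 (by simp)
  le_inf h f g hf hg := (isGLB_sInf_hom A {f, g}).2 (by simp [lowerBounds, hf, hg])
  isLUB_sSup := isLUB_sSup_hom A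
  isGLB_sInf := isGLB_sInf_hom A
  top := sSup Set.univ
  le_top f := (isLUB_sSup_hom A Set.univ).1 (Set.mem_univ f)
  bot := sInf Set.univ
  bot_le f := (isGLB_sInf_hom A Set.univ).1 (Set.mem_univ f)

end

/-- The contravariant functor `Hom(-, [0,1])` from `U`-posets to complete lattices, acting on
morphisms by precomposition. -/
noncomputable def homOfUPos : UPos.{u}ᵒᵖ ⥤ CompleteLat.{u} where
  obj A := ⟨UPosetHom A.unop unitInterval⟩
  map {A B} h :=
    ConcreteCategory.ofHom (C := CompleteLat.{u})
      { toFun := fun f : UPosetHom A.unop unitInterval =>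
          (f.comp (ConcreteCategory.hom h.unop) : UPosetHom B.unop unitInterval)
        map_sInf' := by
          intro S
          refine UPosetHom.ext fun b => ?_
          change sInf ((fun f : UPosetHom A.unop unitInterval => f (_ : A.unop)) '' S) =
            sInf ((fun f : UPosetHom B.unop unitInterval => f b) '' (_ '' S))
          rw [Set.image_image]
          rfl
        map_sSup' := by
          intro S
          refine UPosetHom.ext fun b => ?_
          change sSup ((fun f : UPosetHom A.unop unitInterval => f (_ : A.unop)) '' S) =
            sSup ((fun f : UPosetHom B.unop unitInterval => f b) '' (_ '' S))
          rw [Set.image_image]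
          rfl }
  map_id _ := rfl
  map_comp _ _ := rfl

/-! ### Evaluation -/

/-- Evaluation at a point `x` of a complete lattice `X`, `f ↦ f x`. -/
noncomputable def evalLat (X : Type*) [CompleteLattice X] (x : X) :
    UPosetHom (CompleteLatticeHom X unitInterval) unitInterval where
  toFun f := f x
  monotone' _ _ hfg := hfg x
  map_smul' _ _ := rfl

/-- Evaluation at a point `a` of a `U`-poset `A`, `f ↦ f a`. -/
noncomputable def evalUPos (A : Type*) [UPoset A] (a : A) :
    CompleteLatticeHom (UPosetHom A unitInterval) unitInterval where
  toFun f := f a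
  map_sInf' _ := rfl
  map_sSup' _ := rfl

end UPosetDuality

open UPosetDuality

namespace UPosetDuality

/-! ### Elements of `U` -/

/-! `[0,1]` carries both structures, and they commute: elements of `U` preserve all joins and meets.
So evaluation maps exist on both sides, and the duality reduces to showing that they are order
isomorphisms.

For a lattice, injectivity is a Urysohn argument: the totally-below relation interpolates, and a
dyadic chain in it defines a homomorphism to `[0,1]` (`exists_hom_lt_of_not_le`). For surjectivity,
an equivariant `φ` is evaluation at the join of all `y` whose evaluation lies below `φ`; acting by
steep ramps turns any failure into `1 ≤ 0` (`evalLat_surjective`).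

For a `U`-poset, the Archimedean property and unstackability localise a failure of `a ≤ b` to a pair
of thresholds (`exists_separated_smul_not_le`), and `cutHom` converts this into a separating map.
For surjectivity, a homomorphism `φ` is first matched where its value is 0 or 1. Bisecting `[0,1]`
and stacking then matches it within `2⁻ⁿ` (`exists_eval_approx`), and completeness supplies the
limit. -/

theorem U.map_zero (w : U) : w.1 0 = 0 := by
  obtain ⟨t, ht⟩ := w.2 0
  exact le_antisymm ((U.mono w unitInterval.nonneg').trans ht.le) unitInterval.nonneg'

theorem U.map_one (w : U) : w.1 1 = 1 := by
  obtain ⟨t, ht⟩ := w.2 1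
  exact le_antisymm unitInterval.le_one' (ht.ge.trans (U.mono w unitInterval.le_one'))

theorem U.continuous (w : U) : Continuous w.1 := (U.mono w).continuous_of_surjective w.2

/-- A continuous monotone self-map of the unit interval fixing the endpoints, as an element of
`U`. -/
def U.ofContinuous (f : unitInterval → unitInterval) (hf : Monotone f) (hc : Continuous f)
    (h0 : f 0 = 0) (h1 : f 1 = 1) : U :=
  ⟨⟨f, hf⟩, fun t => by
    have := intermediate_value_Icc (α := unitInterval) zero_le_one hc.continuousOn
    obtain ⟨s, -, hs⟩ := this (a := t)
      (by rw [h0, h1]; exact ⟨unitInterval.nonneg', unitInterval.le_one'⟩)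
    exact ⟨s, hs⟩⟩

/-- The piecewise linear element of `U` which is `0` on `[0,x]`, `1` on `[y,1]`, and affine on
`[x,y]`. -/
noncomputable def ramp (x y : unitInterval) (h : x < y) : U :=
  U.ofContinuous (fun t => Set.projIcc 0 1 zero_le_one (((t : ℝ) - x) / ((y : ℝ) - x)))
    (fun _ _ hst => Set.monotone_projIcc _
      (div_le_div_of_nonneg_right (sub_le_sub_right (α := ℝ) hst _) (sub_nonneg.2 (le_of_lt h))))
    (continuous_projIcc.comp (by fun_prop))
    (Set.projIcc_of_le_left _ (div_nonpos_of_nonpos_of_nonneg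
      (by simpa using x.2.1) (sub_nonneg.2 (le_of_lt h))))
    (Set.projIcc_of_right_le _ (by
      have h' : (x : ℝ) < y := h
      rw [le_div_iff₀ (sub_pos.2 h')]
      simpa using y.2.2))

theorem ramp_apply {x y : unitInterval} (h : x < y) (t : unitInterval) :
    (ramp x y h).1 t = Set.projIcc (0 : ℝ) 1 zero_le_one (((t : ℝ) - x) / ((y : ℝ) - x)) := rfl

theorem ramp_eq_zero {x y : unitInterval} (h : x < y) {t : unitInterval} (ht : t ≤ x) :
    (ramp x y h).1 t = 0 :=
  Set.projIcc_of_le_left zero_le_one (div_nonpos_of_nonpos_of_nonneg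
      (sub_nonpos.2 ht) (sub_nonneg.2 (le_of_lt h)))

theorem ramp_eq_one {x y : unitInterval} (h : x < y) {t : unitInterval} (ht : y ≤ t) :
    (ramp x y h).1 t = 1 :=
  Set.projIcc_of_right_le zero_le_one (by
    have h' : (x : ℝ) < y := h
    rw [le_div_iff₀ (sub_pos.2 h'), one_mul]
    exact sub_le_sub_right (α := ℝ) ht _)

theorem coe_ramp {x y : unitInterval} (h : x < y) {t : unitInterval} (hx : x ≤ t) (hy : t ≤ y) :
    ((ramp x y h).1 t : ℝ) = ((t : ℝ) - x) / ((y : ℝ) - x) := by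
  have h' : (x : ℝ) < y := h
  have hx' : (x : ℝ) ≤ t := hx
  have hy' : (t : ℝ) ≤ y := hy
  rw [ramp_apply, Set.projIcc_of_mem _ (x := ((t : ℝ) - x) / ((y : ℝ) - x))]
  exact ⟨div_nonneg (by linarith) (by linarith), (div_le_one (by linarith)).2 (by linarith)⟩

theorem restrictsToIso_ramp {x y : unitInterval} (h : x < y) :
    RestrictsToIso (ramp x y h) (Set.Icc x y) := by
  have h' : (0 : ℝ) < y - x := sub_pos.2 h
  refine ⟨StrictMono.orderIsoOfSurjective (fun t : Set.Icc x y => (ramp x y h).1 t) ?_ ?_,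
    fun _ => rfl⟩
  · intro s t hst
    change ((ramp x y h).1 s : ℝ) < (ramp x y h).1 t
    rw [coe_ramp h s.2.1 s.2.2, coe_ramp h t.2.1 t.2.2]
    exact div_lt_div_of_pos_right (sub_lt_sub_right (α := ℝ) hst _) h'
  · intro t
    obtain ⟨s, hs⟩ := (ramp x y h).2 t
    rcases le_total s x with hx | hx
    · exact ⟨⟨x, le_rfl, h.le⟩, by
        change (ramp x y h).1 x = t
        rw [ramp_eq_zero h le_rfl, ← hs]
        exact (ramp_eq_zero h hx).symm⟩
    rcases le_total s y with hy | hy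
    · exact ⟨⟨s, hx, hy⟩, hs⟩
    · exact ⟨⟨y, h.le, le_rfl⟩, by
        change (ramp x y h).1 y = t
        rw [ramp_eq_one h le_rfl, ← hs]
        exact (ramp_eq_one h hy).symm⟩

/-! ### Coordinates on the two pieces of `[0,1]` cut at `r`. -/

section RestrictsToIso

variable {v w : U} {r : unitInterval}

theorem RestrictsToIso.lt {s : Set unitInterval} (hv : RestrictsToIso v s) {x y : unitInterval}
    (hx : x ∈ s) (hy : y ∈ s) (h : x < y) : v.1 x < v.1 y := by
  obtain ⟨e, he⟩ := hv
  have := e.strictMono (a := ⟨x, hx⟩) (b := ⟨y, hy⟩) h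
  rwa [he, he] at this

theorem RestrictsToIso.eq_one (hv : RestrictsToIso v (Set.Icc 0 r)) {t : unitInterval}
    (ht : r ≤ t) : v.1 t = 1 := by
  obtain ⟨e, he⟩ := hv
  have h1 := he (e.symm 1)
  rw [e.apply_symm_apply] at h1
  exact le_antisymm unitInterval.le_one' (h1.le.trans (U.mono v ((e.symm 1).2.2.trans ht)))

theorem RestrictsToIso.eq_zero (hw : RestrictsToIso w (Set.Icc r 1)) {t : unitInterval}
    (ht : t ≤ r) : w.1 t = 0 := by
  obtain ⟨e, he⟩ := hw
  have h1 := he (e.symm 0)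
  rw [e.apply_symm_apply] at h1
  exact le_antisymm (le_trans (U.mono w (ht.trans (e.symm 0).2.1)) h1.ge) unitInterval.nonneg'

theorem RestrictsToIso.le_of_le (hv : RestrictsToIso v (Set.Icc 0 r))
    (hw : RestrictsToIso w (Set.Icc r 1)) {s t : unitInterval} (h1 : v.1 s ≤ v.1 t)
    (h2 : w.1 s ≤ w.1 t) : s ≤ t := by
  by_contra hst
  rw [not_le] at hst
  rcases le_total s r with hs | hs
  · exact absurd h1 (not_le.2 (hv.lt ⟨unitInterval.nonneg', hst.le.trans hs⟩
      ⟨unitInterval.nonneg', hs⟩ hst))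
  rcases le_total r t with ht | ht
  · exact absurd h2 (not_le.2 (hw.lt ⟨ht, unitInterval.le_one'⟩ ⟨hs, unitInterval.le_one'⟩ hst))
  · rcases hs.eq_or_lt with rfl | hs
    · exact absurd h1 (not_le.2 (hv.lt ⟨unitInterval.nonneg', ht⟩ ⟨unitInterval.nonneg', le_rfl⟩ hst))
    · have := hw.lt ⟨le_rfl, hs.le.trans unitInterval.le_one'⟩ ⟨hs.le, unitInterval.le_one'⟩ hs
      rw [hw.eq_zero ht] at h2
      exact absurd (h2.trans unitInterval.nonneg') (not_le.2 this)

end RestrictsToIso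

/-! ### The relations `≤_r` -/

theorem LeR.mono {A : Type*} [UPoset A] {r r' : unitInterval} (h : r ≤ r') {a b : A}
    (hab : LeR r a b) : LeR r' a b := fun v w hvw => hab v w fun t =>
  (U.mono v (min_le_min_left (1 : ℝ) (add_le_add_right (α := ℝ) h (t : ℝ)))).trans (hvw t)

theorem UPosetHom.map_leR {A B : Type*} [UPoset A] [UPoset B] (f : UPosetHom A B)
    {r : unitInterval} {a b : A} (h : LeR r a b) : LeR r (f a) (f b) := fun v w hvw => by
  rw [← f.map_smul, ← f.map_smul]
  exact f.mono (h v w hvw)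

/-- If `s > t + r`, a ramp rising between `t + r` and `s` and its translate by `r` form a pair of
test functions that violates the relation. -/
theorem leR_unitInterval {r s t : unitInterval} : LeR r s t ↔ (s : ℝ) ≤ t + r := by
  constructor
  · intro h
    by_contra hlt
    rw [not_le] at hlt
    have hs := s.2.2
    let q : unitInterval := ⟨t + r, add_nonneg t.2.1 r.2.1, by linarith⟩
    have hqs : q < s := hlt
    have hrq : r ≤ q := le_add_of_nonneg_left (α := ℝ) t.2.1
    let v := ramp q s hqs
    -- The least `w` compatible with `v`; it vanishes at `t`, while `v` is 1 at `s`.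
    let w : U := U.ofContinuous (fun t => v.1 (addT t r))
      (fun x y hxy => U.mono v (min_le_min_left (1 : ℝ) (add_le_add_left (α := ℝ) hxy (r : ℝ))))
      ((U.continuous v).comp (Continuous.subtype_mk (by fun_prop) _))
      (ramp_eq_zero hqs (by
        change min 1 (((0 : unitInterval) : ℝ) + r) ≤ q
        exact (min_le_right _ _).trans (by simpa using hrq)))
      (ramp_eq_one hqs (by
        change (s : ℝ) ≤ min 1 (((1 : unitInterval) : ℝ) + r)
        exact le_min s.2.2 (s.2.2.trans (by simpa using r.2.1))))
    have h1 := h v w fun _ => le_rfl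
    have h2 : v.1 s = 1 := ramp_eq_one hqs le_rfl
    have h3 : w.1 t = 0 := ramp_eq_zero hqs (min_le_right (1 : ℝ) _)
    rw [smul_eq, smul_eq, h2, h3] at h1
    exact absurd h1 (not_le.2 zero_lt_one)
  · intro h v w hvw
    exact (U.mono v (show s ≤ addT t r from le_min s.2.2 h)).trans (hvw t)

/-- Identifies `uDist` on homomorphisms with the uniform distance. -/
theorem leR_hom {X : Type*} [CompleteLattice X] {r : unitInterval}
    {f g : CompleteLatticeHom X unitInterval} : LeR r f g ↔ ∀ x, (f x : ℝ) ≤ g x + r := by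
  constructor
  · intro h x
    exact leR_unitInterval.1 fun v w hvw => h v w hvw x
  · intro h v w hvw x
    exact leR_unitInterval.2 (h x) v w hvw

theorem uDist_lt_of_leR {A : Type*} [UPoset A] {r ε : unitInterval} {a b : A} (hr : r < ε)
    (h1 : LeR r a b) (h2 : LeR r b a) : uDist a b < ε :=
  max_lt ((sInf_le h1).trans_lt hr) ((sInf_le h2).trans_lt hr)

theorem leR_of_rho_lt {A : Type*} [UPoset A] {ε : unitInterval} {a b : A} (h : rho a b < ε) :
    LeR ε a b := by
  obtain ⟨r, hr, hlt⟩ := sInf_lt_iff.1 h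
  exact LeR.mono hlt.le hr

theorem leR_of_uDist_lt {A : Type*} [UPoset A] {ε : unitInterval} {a b : A}
    (h : uDist a b < ε) : LeR ε a b ∧ LeR ε b a :=
  ⟨leR_of_rho_lt ((le_max_left _ _).trans_lt h), leR_of_rho_lt ((le_max_right _ _).trans_lt h)⟩

section

/-! ### Homs from a complete lattice form a complete stackable `U`-poset -/

/-- A uniform limit of complete lattice homomorphisms into `[0,1]`. -/
noncomputable def completeLatticeHomOfApprox {X : Type*} [CompleteLattice X]
    (f : X → unitInterval)
    (h : ∀ ε : ℝ, 0 < ε → ∃ g : CompleteLatticeHom X unitInterval,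
      ∀ x, |(g x : ℝ) - f x| ≤ ε) : CompleteLatticeHom X unitInterval where
  toFun := f
  map_sInf' S := by
    apply le_antisymm
    · apply le_sInf
      rintro _ ⟨x, hx, rfl⟩
      refine le_of_forall_pos_le_add (α := ℝ) fun ε hε => ?_
      obtain ⟨g, hg⟩ := h (ε / 2) (half_pos hε)
      have h1 := abs_le.1 (hg (sInf S))
      have h2 := abs_le.1 (hg x)
      have h3 : (g (sInf S) : ℝ) ≤ g x := OrderHomClass.mono g (sInf_le hx)
      linarith
    · refine le_of_forall_pos_le_add (α := ℝ) fun ε hε => ?_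
      -- One third for each passage between `f` and `g`, one for a near-optimal `x` in `S`.
      obtain ⟨g, hg⟩ := h (ε / 3) (by positivity)
      have h1 := abs_le.1 (hg (sInf S))
      by_contra hcon
      rw [not_le] at hcon
      have h2 : (g (sInf S) : ℝ) + ε / 3 < 1 := by
        have : ((sInf (f '' S) : unitInterval) : ℝ) ≤ 1 := unitInterval.le_one _
        linarith
      have h3 : g (sInf S) <
          ⟨g (sInf S) + ε / 3, add_nonneg (g (sInf S)).2.1 (by positivity), h2.le⟩ := by
        change (g (sInf S) : ℝ) < g (sInf S) + ε / 3
        linarith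
      conv_lhs at h3 => rw [map_sInf]
      obtain ⟨_, ⟨x, hx, rfl⟩, h4⟩ := sInf_lt_iff.1 h3
      replace h4 : (g x : ℝ) < g (sInf S) + ε / 3 := h4
      have h5 := abs_le.1 (hg x)
      have h6 : ((sInf (f '' S) : unitInterval) : ℝ) ≤ f x :=
        sInf_le (a := f x) (Set.mem_image_of_mem _ hx)
      linarith
  map_sSup' S := by
    apply le_antisymm
    · refine le_of_forall_pos_le_add (α := ℝ) fun ε hε => ?_
      obtain ⟨g, hg⟩ := h (ε / 3) (by positivity)
      have h1 := abs_le.1 (hg (sSup S))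
      by_contra hcon
      rw [not_le] at hcon
      have h2 : 0 < (g (sSup S) : ℝ) - ε / 3 := by
        have : 0 ≤ ((sSup (f '' S) : unitInterval) : ℝ) := unitInterval.nonneg _
        linarith
      have h3 : ⟨g (sSup S) - ε / 3, h2.le, (sub_le_self _ (by positivity)).trans
          (g (sSup S)).2.2⟩ < g (sSup S) := by
        change (g (sSup S) : ℝ) - ε / 3 < g (sSup S)
        linarith
      conv_rhs at h3 => rw [map_sSup]
      obtain ⟨_, ⟨x, hx, rfl⟩, h4⟩ := lt_sSup_iff.1 h3
      replace h4 : (g (sSup S) : ℝ) - ε / 3 < g x := h4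
      have h5 := abs_le.1 (hg x)
      have h6 : (f x : ℝ) ≤ (sSup (f '' S) : unitInterval) :=
        le_sSup (a := f x) (Set.mem_image_of_mem _ hx)
      linarith
    · apply sSup_le
      rintro _ ⟨x, hx, rfl⟩
      refine le_of_forall_pos_le_add (α := ℝ) fun ε hε => ?_
      obtain ⟨g, hg⟩ := h (ε / 2) (half_pos hε)
      have h1 := abs_le.1 (hg (sSup S))
      have h2 := abs_le.1 (hg x)
      have h3 : (g x : ℝ) ≤ g (sSup S) := OrderHomClass.mono g (le_sSup hx)
      linarith

/-- Below every positive real there is a positive element of the unit interval. -/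
theorem exists_unitInterval_pos_le {ε : ℝ} (hε : 0 < ε) :
    ∃ r : unitInterval, 0 < r ∧ (r : ℝ) ≤ ε :=
  ⟨⟨min 1 ε, le_min zero_le_one hε.le, min_le_left _ _⟩,
    show (0 : ℝ) < min 1 ε from lt_min one_pos hε, min_le_right _ _⟩

variable (X : Type*) [CompleteLattice X]

theorem isCauchyComplete_hom : IsCauchyComplete (CompleteLatticeHom X unitInterval) := by
  constructor
  · intro f g h x
    refine le_of_forall_pos_le_add (α := ℝ) fun ε hε => ?_
    obtain ⟨r, hr, hrε⟩ := exists_unitInterval_pos_le hε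
    have := leR_hom.1 (h r hr) x
    linarith
  · intro s hs
    have key : ∀ ε : ℝ, 0 < ε → ∃ N, ∀ m ≥ N, ∀ n ≥ N, ∀ x,
        |(s m x : ℝ) - s n x| ≤ ε := by
      intro ε hε
      obtain ⟨r, hr, hrε⟩ := exists_unitInterval_pos_le hε
      obtain ⟨N, hN⟩ := hs r hr
      refine ⟨N, fun m hm n hn x => ?_⟩
      obtain ⟨h1, h2⟩ := leR_of_uDist_lt (hN m hm n hn)
      have h1 := leR_hom.1 h1 x
      have h2 := leR_hom.1 h2 x
      rw [abs_le]
      constructor <;> linarith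
    have hlim : ∀ x, ∃ t : unitInterval,
        Filter.Tendsto (fun n => s n x) Filter.atTop (nhds t) := by
      intro x
      apply cauchySeq_tendsto_of_complete
      rw [Metric.cauchySeq_iff]
      intro ε hε
      obtain ⟨N, hN⟩ := key (ε / 2) (half_pos hε)
      exact ⟨N, fun m hm n hn => (hN m hm n hn x).trans_lt (half_lt_self hε)⟩
    choose f hf using hlim
    have key' : ∀ ε : ℝ, 0 < ε → ∃ N, ∀ n ≥ N, ∀ x, |(s n x : ℝ) - f x| ≤ ε := by
      intro ε hε
      obtain ⟨N, hN⟩ := key ε hε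
      refine ⟨N, fun n hn x => ?_⟩
      have hc : Filter.Tendsto (fun m => |(s n x : ℝ) - s m x|) Filter.atTop
          (nhds |(s n x : ℝ) - f x|) :=
        ((tendsto_const_nhds.sub ((continuous_subtype_val.tendsto _).comp (hf x)))).abs
      exact le_of_tendsto hc (Filter.eventually_atTop.2 ⟨N, fun m hm => hN n hn m hm x⟩)
    refine ⟨completeLatticeHomOfApprox f fun ε hε => ?_, fun ε hε => ?_⟩
    · obtain ⟨N, hN⟩ := key' ε hε
      exact ⟨s N, hN N le_rfl⟩
    · obtain ⟨r, hr0, hr⟩ := exists_between hε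
      obtain ⟨N, hN⟩ := key' r hr0
      refine ⟨N, fun n hn => uDist_lt_of_leR hr (leR_hom.2 fun x => ?_) (leR_hom.2 fun x => ?_)⟩
      · have := abs_le.1 (hN n hn x)
        change (s n x : ℝ) ≤ f x + r
        linarith
      · have := abs_le.1 (hN n hn x)
        change (f x : ℝ) ≤ s n x + r
        linarith

theorem isStackable_hom : IsStackable (CompleteLatticeHom X unitInterval) := by
  refine ⟨fun r _ _ v w hv hw f g h1 h2 x => hv.le_of_le hw (h1 x) (h2 x), ?_⟩
  intro r hr0 hr1 v w hv hw f g hfg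
  -- Otherwise some ramps send `f x` to 0 and `g x` to 1, contradicting `hfg`. So `(f x, g x)` lies
  -- on the L-shaped image of `t ↦ (v t, w t)`.
  have hx : ∀ x, g x = 0 ∨ f x = 1 := by
    intro x
    by_contra! hcon
    have h1 := hfg (ramp (f x) 1 (lt_of_le_of_ne unitInterval.le_one' hcon.2))
      (ramp 0 (g x) (lt_of_le_of_ne unitInterval.nonneg' hcon.1.symm)) x
    rw [homUPoset_smul_apply, homUPoset_smul_apply, ramp_eq_zero _ le_rfl,
      ramp_eq_one _ le_rfl] at h1
    exact absurd h1 (not_le.2 zero_lt_one)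
  have hc : ∀ x, ∃ t, v.1 t = f x ∧ w.1 t = g x := by
    intro x
    rcases hx x with h | h
    · obtain ⟨t, ht⟩ := v.2 (f x)
      refine ⟨min t r, ?_, ?_⟩
      · rw [(U.mono v).map_min, hv.eq_one le_rfl, min_eq_left unitInterval.le_one', ← ht]
      · rw [h, hw.eq_zero (min_le_right _ _)]
    · obtain ⟨t, ht⟩ := w.2 (g x)
      refine ⟨max t r, ?_, ?_⟩
      · rw [h, hv.eq_one (le_max_right _ _)]
      · rw [(U.mono w).map_max, hw.eq_zero le_rfl, max_eq_left unitInterval.nonneg', ← ht]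
  choose c hcv hcw using hc
  -- `v` and `w` are jointly injective, so `c` preserves joins and meets because both of its
  -- coordinates do.
  have ext : ∀ s t, v.1 s = v.1 t → w.1 s = w.1 t → s = t := fun s t h1 h2 =>
    le_antisymm (hv.le_of_le hw h1.le h2.le) (hv.le_of_le hw h1.ge h2.ge)
  refine ⟨⟨⟨c, fun S => ?_⟩, fun S => ?_⟩, DFunLike.ext _ _ hcv, DFunLike.ext _ _ hcw⟩
  · apply ext
    · rw [hcv, U.map_sInf, map_sInf, Set.image_image]
      simp only [hcv]
    · rw [hcw, U.map_sInf, map_sInf, Set.image_image]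
      simp only [hcw]
  · apply ext
    · change v.1 (c _) = v.1 (sSup (c '' _))
      rw [hcv, U.map_sSup, map_sSup, Set.image_image]
      simp only [hcv]
    · change w.1 (c _) = w.1 (sSup (c '' _))
      rw [hcw, U.map_sSup, map_sSup, Set.image_image]
      simp only [hcw]

/-! ### Equivariant maps into `[0,1]` form a completely distributive lattice -/

section

variable {A : Type*} [UPoset A]

theorem hom_iSup_apply {ι : Sort*} (f : ι → UPosetHom A unitInterval) (a : A) :
    (⨆ i, f i) a = ⨆ i, f i a := by
  change sSup ((fun g : UPosetHom A unitInterval => g a) '' Set.range f) = _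
  rw [← Set.range_comp]
  rfl

theorem hom_iInf_apply {ι : Sort*} (f : ι → UPosetHom A unitInterval) (a : A) :
    (⨅ i, f i) a = ⨅ i, f i a := by
  change sInf ((fun g : UPosetHom A unitInterval => g a) '' Set.range f) = _
  rw [← Set.range_comp]
  rfl

end

theorem completelyDistrib_hom (A : Type u) [UPoset A] :
    CompletelyDistribLattice.MinimalAxioms (UPosetHom A unitInterval) where
  iInf_iSup_eq f := UPosetHom.ext fun a => by
    simp only [hom_iSup_apply, hom_iInf_apply]
    exact iInf_iSup_eq

end

/-! ### Evaluation on a completely distributive lattice -/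

section TotallyBelow

variable {X : Type u} [CompleteLattice X]

/-- `x` is totally below `y`: any family whose join is above `y` has a member above `x`. -/
def TotallyBelow (x y : X) : Prop := ∀ S : Set X, y ≤ sSup S → ∃ s ∈ S, x ≤ s

theorem TotallyBelow.le {x y : X} (h : TotallyBelow x y) : x ≤ y := by
  obtain ⟨s, rfl, hs⟩ := h {y} sSup_singleton.ge
  exact hs

theorem TotallyBelow.trans_le {x y z : X} (h : TotallyBelow x y) (h' : y ≤ z) :
    TotallyBelow x z := fun S hS => h S (h'.trans hS)

theorem TotallyBelow.trans {x y z : X} (h : TotallyBelow x y) (h' : TotallyBelow y z) :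
    TotallyBelow x z := h.trans_le h'.le

/-- Apply complete distributivity to all families whose join is above `y`: a choice of one member
from each has a meet that is totally below `y`. -/
theorem le_sSup_totallyBelow (hX : CompletelyDistribLattice.MinimalAxioms X) (y : X) :
    y ≤ sSup {x | TotallyBelow x y} := by
  have h := hX.iInf_iSup_eq (ι := {S : Set X // y ≤ sSup S}) (κ := fun S => S.1)
    (fun _ s => s.1)
  calc y ≤ ⨅ S : {S : Set X // y ≤ sSup S}, ⨆ s : S.1, s.1 :=
        le_iInf fun S => S.2.trans (sSup_eq_iSup' S.1).le
    _ ≤ _ := h.le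
    _ ≤ _ := iSup_le fun g => le_sSup fun S hS => ⟨g ⟨S, hS⟩, (g ⟨S, hS⟩).2, iInf_le _ _⟩

/-- Approximating `z` from totally below twice writes it as a join of elements two steps down; the
definition of `TotallyBelow`, applied to this join, picks one above `x`. -/
theorem TotallyBelow.exists_between (hX : CompletelyDistribLattice.MinimalAxioms X) {x z : X}
    (h : TotallyBelow x z) : ∃ y, TotallyBelow x y ∧ TotallyBelow y z := by
  obtain ⟨x', ⟨y, h1, h2⟩, hx⟩ := h {x' | ∃ y, TotallyBelow x' y ∧ TotallyBelow y z}
    ((le_sSup_totallyBelow hX z).trans (sSup_le fun y hy => (le_sSup_totallyBelow hX y).trans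
      (sSup_le_sSup fun x' hx' => ⟨y, hx', hy⟩)))
  exact ⟨y, fun S hS => (h1 S hS).imp fun s hs => ⟨hs.1, hx.trans hs.2⟩, h2⟩

end TotallyBelow

/-- The `n`-th dyadic refinement of the sequence `y`, with new terms inserted by `m`. -/
def dyadicRefine {X : Type*} (m : X → X → X) (y : ℕ → X) : ℕ → ℕ → X
  | 0, k => y k
  | n + 1, k => if k % 2 = 0 then dyadicRefine m y n (k / 2)
      else m (dyadicRefine m y n (k / 2)) (dyadicRefine m y n (k / 2 + 1))

/-! ### Dyadic chains for an interpolating transitive relation. -/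

section DyadicRefine

variable {X : Type*} {m : X → X → X} {y : ℕ → X} {R : X → X → Prop}

theorem dyadicRefine_succ (hm : ∀ a b, R a b → R a (m a b) ∧ R (m a b) b)
    (hy : ∀ k, R (y k) (y (k + 1))) (n k : ℕ) :
    R (dyadicRefine m y n k) (dyadicRefine m y n (k + 1)) := by
  induction n generalizing k with
  | zero => exact hy k
  | succ n ih =>
    simp only [dyadicRefine]
    rcases Nat.mod_two_eq_zero_or_one k with h | h
    · rw [if_pos h, if_neg (by omega), show (k + 1) / 2 = k / 2 by omega]
      exact (hm _ _ (ih _)).1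
    · rw [if_neg (by omega), if_pos (by omega), show (k + 1) / 2 = k / 2 + 1 by omega]
      exact (hm _ _ (ih _)).2

theorem dyadicRefine_mul (n d k : ℕ) :
    dyadicRefine m y (n + d) (k * 2 ^ d) = dyadicRefine m y n k := by
  induction d with
  | zero => simp
  | succ d ih =>
    rw [← add_assoc, pow_succ, ← mul_assoc]
    simp only [dyadicRefine]
    rw [if_pos (by omega), Nat.mul_div_cancel _ two_pos, ih]

/-- Both terms reappear at level `n + n'`, where they are joined by a chain of consecutive
relations. -/
theorem dyadicRefine_of_lt (hm : ∀ a b, R a b → R a (m a b) ∧ R (m a b) b)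
    (hR : ∀ a b c, R a b → R b c → R a c)
    (hy : ∀ k, R (y k) (y (k + 1))) {n k n' k' : ℕ} (h : (k : ℝ) / 2 ^ n < k' / 2 ^ n') :
    R (dyadicRefine m y n k) (dyadicRefine m y n' k') := by
  rw [div_lt_div_iff₀ (by positivity) (by positivity)] at h
  have h' : k * 2 ^ n' < k' * 2 ^ n := by exact_mod_cast h
  rw [← dyadicRefine_mul n n' k, ← dyadicRefine_mul n' n k', add_comm n' n]
  have : IsTrans X R := ⟨hR⟩
  exact Nat.rel_of_forall_rel_succ_of_lt R (dyadicRefine_succ hm hy _) h'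

end DyadicRefine

theorem exists_dyadic_btwn {s t : ℝ} (hs : 0 ≤ s) (h : s < t) :
    ∃ n k : ℕ, s < k / 2 ^ n ∧ (k : ℝ) / 2 ^ n < t := by
  obtain ⟨n, hn⟩ := exists_pow_lt_of_lt_one (sub_pos.2 h) (one_half_lt_one (α := ℝ))
  have h2 : (0 : ℝ) < 2 ^ n := by positivity
  rw [one_div, inv_pow, inv_lt_iff_one_lt_mul₀ h2] at hn
  refine ⟨n, ⌊s * 2 ^ n⌋₊ + 1, ?_, ?_⟩
  · rw [lt_div_iff₀ h2]
    exact_mod_cast Nat.lt_floor_add_one (s * 2 ^ n)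
  · rw [div_lt_iff₀ h2]
    have := Nat.floor_le (mul_nonneg hs h2.le)
    push_cast
    nlinarith

/-! ### Separation of points and surjectivity of evaluation. -/

section

variable {X : Type u} [CompleteLattice X]

/-- Complete homomorphisms into `[0,1]` separate the points of a completely distributive
lattice. -/
theorem exists_hom_lt_of_not_le (hX : CompletelyDistribLattice.MinimalAxioms X) {x y : X}
    (hxy : ¬ x ≤ y) : ∃ f : CompleteLatticeHom X unitInterval, f y < f x := by
  obtain ⟨z, hzx, hzy⟩ : ∃ z, TotallyBelow z x ∧ ¬ z ≤ y := by
    by_contra! h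
    exact hxy ((le_sSup_totallyBelow hX x).trans (sSup_le h))
  -- Totalised, with a junk value off the relation, so that interpolation becomes a binary operation
  -- `m`.
  have hint : ∀ a b : X, ∃ c, TotallyBelow a b → TotallyBelow a c ∧ TotallyBelow c b := by
    intro a b
    by_cases h : TotallyBelow a b
    · exact (h.exists_between hX).imp fun c hc _ => hc
    · exact ⟨a, fun h' => absurd h' h⟩
  choose m hm using hint
  -- An endless chain below `x` gives the refinement a related successor at every index; `val` later
  -- truncates positions beyond 1.
  let s : ℕ → X := fun k => (fun a => m a x)^[k] z
  have hsx : ∀ k, TotallyBelow (s k) x := by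
    intro k
    induction k with
    | zero => exact hzx
    | succ k ih =>
      simp only [s, Function.iterate_succ_apply']
      exact (hm _ _ ih).2
  have hs : ∀ k, TotallyBelow (s k) (s (k + 1)) := by
    intro k
    simp only [s, Function.iterate_succ_apply']
    exact (hm _ _ (hsx k)).1
  let H := dyadicRefine m s
  have hH : ∀ {n k n' k' : ℕ}, (k : ℝ) / 2 ^ n < k' / 2 ^ n' →
      TotallyBelow (H n k) (H n' k') :=
    dyadicRefine_of_lt hm (fun _ _ _ h h' => h.trans h') hs
  let val : ℕ → ℕ → unitInterval := fun n k =>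
    ⟨min 1 ((k : ℝ) / 2 ^ n), le_min zero_le_one (by positivity), min_le_left _ _⟩
  have hval : ∀ {n k n' k'}, val n k < val n' k' → (k : ℝ) / 2 ^ n < k' / 2 ^ n' := by
    intro n k n' k' h
    have h' : min 1 ((k : ℝ) / 2 ^ n) < min 1 ((k' : ℝ) / 2 ^ n') := h
    by_contra! hcon
    exact absurd h' (not_lt.2 (min_le_min_left _ hcon))
  have hdense : ∀ {p q : unitInterval}, p < q → ∃ n k, p < val n k ∧ val n k < q := by
    intro p q hpq
    obtain ⟨n, k, h1, h2⟩ := exists_dyadic_btwn p.2.1 hpq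
    refine ⟨n, k, lt_min (α := ℝ) (lt_of_lt_of_le hpq q.2.2) h1, ?_⟩
    exact lt_of_le_of_lt (α := ℝ) (min_le_right _ _) h2
  let S : X → Set unitInterval := fun a => {t | ∃ n k, val n k = t ∧ H n k ≤ a}
  have hmono : ∀ {a b}, a ≤ b → sSup (S a) ≤ sSup (S b) := fun hab =>
    sSup_le_sSup fun _ ⟨n, k, h1, h2⟩ => ⟨n, k, h1, h2.trans hab⟩
  let f : CompleteLatticeHom X unitInterval :=
    { toFun := fun a => sSup (S a)
      map_sInf' := by
        intro T
        apply le_antisymm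
        · apply le_sInf
          rintro _ ⟨a, ha, rfl⟩
          exact hmono (sInf_le ha)
        -- A single dyadic between `p` and the meet of the values serves every `a ∈ T` at once.
        · refine le_of_forall_lt fun p hp => ?_
          obtain ⟨n, k, h1, h2⟩ := hdense hp
          refine h1.trans_le (le_sSup ⟨n, k, rfl, le_sInf fun a ha => ?_⟩)
          obtain ⟨_, ⟨n', k', rfl, hle⟩, h3⟩ :=
            lt_sSup_iff.1 (h2.trans_le (sInf_le (Set.mem_image_of_mem _ ha)))
          exact (hH (hval h3)).le.trans hle
      map_sSup' := by
        intro T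
        apply le_antisymm
        · refine le_of_forall_lt fun p hp => ?_
          obtain ⟨_, ⟨n, k, rfl, hle⟩, h1⟩ := lt_sSup_iff.1 hp
          obtain ⟨n', k', h2, h3⟩ := hdense h1
          -- A strictly smaller dyadic has its chain element totally below the join of `T`, hence
          -- below one member.
          obtain ⟨a, ha, hle'⟩ := hH (hval h3) T hle
          exact h2.trans_le (le_trans (le_sSup (show val n' k' ∈ S a from ⟨n', k', rfl, hle'⟩))
            (le_sSup (Set.mem_image_of_mem _ ha)))
        · apply sSup_le
          rintro _ ⟨a, ha, rfl⟩
          exact hmono (le_sSup ha) }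
  have hx : f x = 1 := by
    refine le_antisymm unitInterval.le_one' (le_sSup ⟨0, 1, ?_, (hsx 1).le⟩)
    apply Subtype.ext
    simp [val]
  have hy : f y = 0 := by
    refine le_antisymm (sSup_le ?_) unitInterval.nonneg'
    rintro _ ⟨n, k, rfl, hle⟩
    refine absurd (le_trans ?_ hle) hzy
    rcases Nat.eq_zero_or_pos k with rfl | hk
    · have := dyadicRefine_mul (m := m) (y := s) 0 n 0
      rw [zero_mul, zero_add] at this
      exact this.ge
    · have : TotallyBelow (H 0 0) (H n k) := hH (by
        rw [Nat.cast_zero, zero_div]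
        positivity)
      exact this.le
  exact ⟨f, by rw [hx, hy]; exact zero_lt_one⟩

theorem evalLat_le_iff (hX : CompletelyDistribLattice.MinimalAxioms X) {x y : X} :
    evalLat X x ≤ evalLat X y ↔ x ≤ y := by
  refine ⟨fun h => ?_, fun h f => OrderHomClass.mono f h⟩
  by_contra hxy
  obtain ⟨f, hf⟩ := exists_hom_lt_of_not_le hX hxy
  exact absurd (h f) (not_le.2 hf)

theorem evalLat_surjective : Function.Surjective (evalLat X) := by
  intro φ
  let T : Set X := {y | ∀ f : CompleteLatticeHom X unitInterval, f y ≤ φ f}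
  refine ⟨sSup T, le_antisymm (fun f => ?_) (fun f => ?_)⟩
  · change f (sSup T) ≤ φ f
    rw [map_sSup]
    apply sSup_le
    rintro _ ⟨y, hy, rfl⟩
    exact hy f
  · change φ f ≤ f (sSup T)
    by_contra hlt
    rw [not_le] at hlt
    obtain ⟨t, ht1, ht2⟩ := exists_between hlt
    let y : X := sInf {y | t ≤ f y}
    have hty : t ≤ f y := by
      rw [map_sInf]
      apply le_sInf
      rintro _ ⟨z, hz, rfl⟩
      exact hz
    have hy : y ∈ T := by
      intro g
      by_contra hg
      rw [not_le] at hg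
      -- Where `f z > t`, minimality gives `y ≤ z`, so the right side is already 1. Applying `φ`
      -- yields `1 ≤ 0`.
      have hle : ramp t (φ f) ht2 • f ≤ ramp (φ g) (g y) hg • g := by
        intro z
        rw [homUPoset_smul_apply, homUPoset_smul_apply]
        rcases le_total (f z) t with h | h
        · rw [ramp_eq_zero _ h]
          exact unitInterval.nonneg'
        · rw [ramp_eq_one hg (OrderHomClass.mono g (sInf_le h))]
          exact unitInterval.le_one'
      have := φ.mono hle
      rw [φ.map_smul, φ.map_smul, smul_eq, smul_eq, ramp_eq_one _ le_rfl,
        ramp_eq_zero _ le_rfl] at this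
      exact absurd this (not_le.2 zero_lt_one)
    exact absurd (hty.trans (OrderHomClass.mono f (le_sSup hy))) (not_le.2 ht1)

/-- Evaluation as an order isomorphism, for a completely distributive lattice. -/
noncomputable def evalLatIso (hX : CompletelyDistribLattice.MinimalAxioms X) :
    X ≃o UPosetHom (CompleteLatticeHom X unitInterval) unitInterval :=
  RelIso.ofSurjective (OrderEmbedding.ofMapLEIff (evalLat X) fun _ _ => evalLat_le_iff hX)
    evalLat_surjective

end

/-! ### Evaluation on a complete stackable `U`-poset -/

section

variable {A : Type*} [UPoset A]

/-- The set of `s` such that every `v : U` with `v s = 1` sends `c` to an element `v • c` which is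
above `a` however both are moved by `U`. -/
def cutSet (a c : A) : Set unitInterval :=
  {s | ∀ v : U, v.1 s = 1 → ∀ w w' : U, w • a ≤ w' • v • c}

/-- The equivariant map `c ↦ sSup (cutSet a c)`. -/
noncomputable def cutHom (a : A) : UPosetHom A unitInterval where
  toFun c := sSup (cutSet a c)
  monotone' c d hcd := sSup_le_sSup fun s hs v hv w w' =>
    (hs v hv w w').trans (UPoset.smul_mono le_rfl (UPoset.smul_mono le_rfl hcd))
  map_smul' w c := by
    rw [smul_eq]
    apply le_antisymm
    · by_contra hlt
      rw [not_le] at hlt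
      obtain ⟨s, hs, hlt⟩ := lt_sSup_iff.1 hlt
      obtain ⟨y, hy1, hy2⟩ := exists_between hlt
      obtain ⟨x, rfl⟩ := w.2 y
      -- With `x` chosen so that `w x` lies just below `s`, the point `x` belongs to `cutSet a c`:
      -- the ramp from `w x` to `s`, composed with `w`, is below every `v` with `v x = 1`.
      refine absurd hy1 (not_lt.2 (U.mono w (le_sSup ?_)))
      intro v hv u u'
      refine (hs (ramp (w.1 x) s hy2) (ramp_eq_one _ le_rfl) u u').trans
        (UPoset.smul_mono le_rfl ?_)
      rw [← mul_smul]
      refine UPoset.smul_mono (fun t => ?_) le_rfl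
      change (ramp (w.1 x) s hy2).1 (w.1 t) ≤ v.1 t
      rcases le_total t x with h | h
      · rw [ramp_eq_zero _ (U.mono w h)]
        exact unitInterval.nonneg'
      · exact unitInterval.le_one'.trans (hv.ge.trans (U.mono v h))
    · rw [U.map_sSup]
      apply sSup_le
      rintro _ ⟨s, hs, rfl⟩
      apply le_sSup
      intro v hv u u'
      rw [← mul_smul v w]
      exact hs (v * w) hv u u'

theorem smul_le_smul_of_separated {p : unitInterval} {v w : U} (hv : v.1 p = 0) (hw : w.1 p = 1)
    (a : A) : v • a ≤ w • a := by
  refine UPoset.smul_mono (fun t => ?_) le_rfl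
  rcases le_total t p with h | h
  · exact (U.mono v h).trans (hv.le.trans unitInterval.nonneg')
  · exact unitInterval.le_one'.trans (hw.ge.trans (U.mono w h))

/-- The Archimedean property gives a shift `r` witnessing the failure. If every separated pair
satisfied the inequality, it would hold on all windows shorter than `r`, and unstackability would
glue these into all of `[0,1]`. -/
theorem exists_separated_smul_not_le (hA : IsArchimedean A) (hU : IsUnstackable A) {a b : A}
    (hab : ¬ a ≤ b) : ∃ (p' p : unitInterval) (v w : U),
      p' < p ∧ v.1 p = 0 ∧ w.1 p' = 1 ∧ ¬ v • a ≤ w • b := by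
  obtain ⟨r, hr, u, v, huv, hnle⟩ : ∃ r : unitInterval, 0 < r ∧ ∃ u v : U,
      (∀ t, u.1 (addT t r) ≤ v.1 t) ∧ ¬ u • a ≤ v • b := by
    by_contra! h
    exact hab (hA a b h)
  by_contra! hcon
  -- The inequality as seen through the window `[u x, u y]`: `w` collapses everything outside it.
  let P : unitInterval → unitInterval → Prop := fun x y => ∀ w : U, w.1 (u.1 x) = 0 →
    w.1 (u.1 y) = 1 → w • u • a ≤ w • v • b
  have hP : ∀ x y : unitInterval, (y : ℝ) < x + r → P x y := by
    intro x y hxy w hx hy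
    rcases lt_or_ge (y : ℝ) r with hyr | hyr
    · have h1 : w.1 (u.1 y) ≤ w.1 (v.1 0) :=
        U.mono w ((U.mono u (show y ≤ addT 0 r from le_min y.2.2 (by simpa using hyr.le))).trans
          (huv 0))
      rw [hy, U.map_zero, U.map_zero] at h1
      exact absurd h1 (not_le.2 zero_lt_one)
    -- Since `u` at `p' + r = y` is at most `v p'`, the map `w * v` is 1 at `p'`, and `p' < x`.
    · let p' : unitInterval := ⟨y - r, sub_nonneg.2 hyr, (sub_le_self _ r.2.1).trans y.2.2⟩
      have h1 : y ≤ addT p' r := le_min y.2.2 (by simp [p'])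
      have h2 : p' < x := sub_lt_iff_lt_add.2 hxy
      have := hcon p' x (w * u) (w * v) h2 hx (le_antisymm unitInterval.le_one'
        (hy.ge.trans (U.mono w ((U.mono u h1).trans (huv p')))))
      rwa [mul_smul, mul_smul] at this
  have htrans : ∀ x y z, P x y → P y z → P x z := by
    intro x y z hxy hyz w hx hz
    -- If `w` collapses one of the two subwindows, the other suffices; otherwise cut `[0,1]` at `w
    -- (u y)`.
    rcases (unitInterval.nonneg' (t := w.1 (u.1 y))).eq_or_lt with h0 | h0
    · exact hyz w h0.symm hz
    rcases (unitInterval.le_one' (t := w.1 (u.1 y))).eq_or_lt with h1 | h1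
    · exact hxy w hx h1
    · refine hU _ h0 h1 (ramp _ _ h0) (ramp _ _ h1) (restrictsToIso_ramp h0)
        (restrictsToIso_ramp h1) _ _ ?_ ?_
      · have := hxy (ramp _ _ h0 * w) (ramp_eq_zero h0 hx.le) (ramp_eq_one h0 le_rfl)
        rwa [mul_smul, mul_smul] at this
      · have := hyz (ramp _ _ h1 * w) (ramp_eq_zero h1 le_rfl) (ramp_eq_one h1 hz.ge)
        rwa [mul_smul, mul_smul] at this
  have hr' : (0 : ℝ) < r := hr
  -- Windows of width `r / 2`, since `hP` needs width strictly below `r`.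
  have hk : ∀ (k : ℕ) (y : unitInterval), (y : ℝ) ≤ k * (r / 2) → P 0 y := by
    intro k
    induction k with
    | zero =>
      intro y hy
      apply hP
      have : ((0 : unitInterval) : ℝ) = 0 := rfl
      rw [Nat.cast_zero, zero_mul] at hy
      linarith
    | succ k ih =>
      intro y hy
      push_cast at hy
      let x : unitInterval := ⟨max 0 (y - r / 2), le_max_left _ _,
        max_le zero_le_one (by linarith [y.2.2])⟩
      have hx : (y : ℝ) - r / 2 ≤ x := le_max_right _ _
      refine htrans 0 x y (ih x (max_le (by positivity) (by linarith))) (hP x y (by linarith))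
  obtain ⟨k, hk'⟩ := exists_nat_gt (1 / ((r : ℝ) / 2))
  rw [div_lt_iff₀ (by positivity)] at hk'
  have := hk k 1 hk'.le 1 (U.map_zero u) (U.map_one u)
  rw [one_smul, one_smul] at this
  exact hnle this

/-- Equivariant monotone maps into `[0,1]` detect the order of an Archimedean unstackable
`U`-poset. -/
theorem le_of_forall_hom_le (hA : IsArchimedean A) (hU : IsUnstackable A) {a b : A}
    (h : ∀ f : UPosetHom A unitInterval, f a ≤ f b) : a ≤ b := by
  by_contra hab
  obtain ⟨p', p, v, w, hp, hv, hw, hnle⟩ := exists_separated_smul_not_le hA hU hab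
  -- The cut at `v • a` separates: its value is at least `p` at `a` and at most `p' < p` at `b`.
  have h1 : p ≤ cutHom (v • a) a := by
    refine le_sSup fun k hk u u' => ?_
    rw [← mul_smul, ← mul_smul]
    refine smul_le_smul_of_separated (p := p) ?_ ?_ a
    · exact (congrArg u.1 hv).trans (U.map_zero u)
    · exact (congrArg u'.1 hk).trans (U.map_one u')
  have h2 : cutHom (v • a) b ≤ p' := by
    refine sSup_le fun s hs => ?_
    by_contra hlt
    rw [not_le] at hlt
    have := hs (ramp p' s hlt) (ramp_eq_one hlt le_rfl) 1 1
    rw [one_smul, one_smul] at this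
    exact hnle (this.trans (smul_le_smul_of_separated (ramp_eq_zero hlt le_rfl) hw b))
  exact absurd (h1.trans ((h _).trans h2)) (not_le.2 hp)

theorem leR_of_forall_hom (hA : IsArchimedean A) (hU : IsUnstackable A) {r : unitInterval}
    {a b : A} (h : ∀ f : UPosetHom A unitInterval, (f a : ℝ) ≤ f b + r) : LeR r a b :=
  fun v w hvw => le_of_forall_hom_le hA hU fun f => by
    rw [f.map_smul, f.map_smul]
    exact leR_unitInterval.2 (h f) v w hvw

theorem evalUPos_le_iff (hA : IsArchimedean A) (hU : IsUnstackable A) {a b : A} :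
    evalUPos A a ≤ evalUPos A b ↔ a ≤ b :=
  ⟨fun h => le_of_forall_hom_le hA hU h, fun h f => f.mono h⟩

/-- The largest `x₀` with `φ = 0` and the least `x₁` with `φ = 1` satisfy `¬ x₁ ≤ x₀`. A point
witnessing this, stretched by a ramp, works for all `f` simultaneously. -/
theorem exists_eval_extremal (φ : CompleteLatticeHom (UPosetHom A unitInterval) unitInterval) :
    ∃ a : A, ∀ f : UPosetHom A unitInterval, (φ f = 0 → f a = 0) ∧ (φ f = 1 → f a = 1) := by
  let x₀ : UPosetHom A unitInterval := sSup {f | φ f = 0}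
  let x₁ : UPosetHom A unitInterval := sInf {f | φ f = 1}
  have h0 : φ x₀ ≤ 0 := by
    rw [map_sSup]
    apply sSup_le
    rintro _ ⟨f, hf, rfl⟩
    exact le_of_eq hf
  have h1 : 1 ≤ φ x₁ := by
    rw [map_sInf]
    apply le_sInf
    rintro _ ⟨f, hf, rfl⟩
    exact ge_of_eq hf
  obtain ⟨a, ha⟩ : ∃ a, x₀ a < x₁ a := by
    by_contra! h
    exact absurd (h1.trans ((OrderHomClass.mono φ (show x₁ ≤ x₀ from h)).trans h0))
      (not_le.2 zero_lt_one)
  refine ⟨ramp _ _ ha • a, fun f => ⟨fun hf => ?_, fun hf => ?_⟩⟩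
  · rw [f.map_smul, smul_eq]
    exact ramp_eq_zero ha ((isLUB_sSup_hom A {f | φ f = 0}).1 hf a)
  · rw [f.map_smul, smul_eq]
    exact ramp_eq_one ha ((isGLB_sInf_hom A {f | φ f = 1}).1 hf a)

/-- The midpoint of the unit interval. -/
noncomputable def half : unitInterval := ⟨1 / 2, by norm_num, by norm_num⟩

theorem half_pos' : 0 < half := show (0 : ℝ) < 1 / 2 by norm_num

theorem half_lt_one' : half < 1 := show (1 / 2 : ℝ) < 1 by norm_num

theorem coe_ramp_zero_half {t : unitInterval} (ht : t ≤ half) :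
    ((ramp 0 half half_pos').1 t : ℝ) = 2 * t := by
  rw [coe_ramp _ unitInterval.nonneg' ht]
  simp [half, mul_comm]

theorem coe_ramp_half_one {t : unitInterval} (ht : half ≤ t) :
    ((ramp half 1 half_lt_one').1 t : ℝ) = 2 * t - 1 := by
  rw [coe_ramp _ ht unitInterval.le_one']
  simp only [half, Set.Icc.coe_one]
  ring

/-- Approximate the lower and upper halves of `φ`, each rescaled to `[0,1]`, and stack the results;
undoing the rescaling halves the error. The clauses at 0 and 1 are carried along because they make
the two approximants stackable. -/
theorem exists_eval_approx (hA : IsArchimedean A) (hS : IsStackable A) (n : ℕ)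
    (φ : CompleteLatticeHom (UPosetHom A unitInterval) unitInterval) :
    ∃ a : A, ∀ f : UPosetHom A unitInterval, (φ f = 0 → f a = 0) ∧ (φ f = 1 → f a = 1) ∧
      |(f a : ℝ) - φ f| ≤ (1 / 2) ^ n := by
  induction n generalizing φ with
  | zero =>
    obtain ⟨a, ha⟩ := exists_eval_extremal φ
    refine ⟨a, fun f => ⟨(ha f).1, (ha f).2, ?_⟩⟩
    rw [pow_zero, abs_le]
    constructor <;> linarith [(f a).2.1, (f a).2.2, (φ f).2.1, (φ f).2.2]
  | succ n ih =>
    obtain ⟨a₀, ha₀⟩ := ih (ramp 0 half half_pos' • φ)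
    obtain ⟨a₁, ha₁⟩ := ih (ramp half 1 half_lt_one' • φ)
    have hlow : ∀ f : UPosetHom A unitInterval, φ f ≤ half → f a₁ = 0 := fun f hf =>
      (ha₁ f).1 (ramp_eq_zero half_lt_one' hf)
    have hhigh : ∀ f : UPosetHom A unitInterval, half ≤ φ f → f a₀ = 1 := fun f hf =>
      (ha₀ f).2.1 (ramp_eq_one half_pos' hf)
    obtain ⟨c, hc₀, hc₁⟩ := hS.2 half half_pos' half_lt_one' _ _ (restrictsToIso_ramp half_pos')
      (restrictsToIso_ramp half_lt_one') a₀ a₁ (fun v w => le_of_forall_hom_le hA hS.1 fun f => by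
        rw [f.map_smul, f.map_smul, smul_eq, smul_eq]
        rcases le_total (φ f) half with h | h
        · rw [hlow f h, U.map_zero]
          exact unitInterval.nonneg'
        · rw [hhigh f h, U.map_one]
          exact unitInterval.le_one')
    have hcoe : (half : ℝ) = 1 / 2 := rfl
    refine ⟨c, fun f => ?_⟩
    have h₀ : (ramp 0 half half_pos').1 (f c) = f a₀ := by rw [← hc₀, f.map_smul, smul_eq]
    have h₁ : (ramp half 1 half_lt_one').1 (f c) = f a₁ := by rw [← hc₁, f.map_smul, smul_eq]
    rcases le_total (φ f) half with h | h
    · have hfc : f c ≤ half := by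
        by_contra! hlt
        have h2 := coe_ramp_half_one hlt.le
        rw [h₁, hlow f h, Set.Icc.coe_zero] at h2
        have h3 : (half : ℝ) < f c := hlt
        linarith
      have h2 := coe_ramp_zero_half hfc
      rw [h₀] at h2
      have h3 : (((ramp 0 half half_pos' • φ) f : unitInterval) : ℝ) = 2 * φ f :=
        coe_ramp_zero_half h
      refine ⟨fun h0 => ?_, fun h0 => ?_, ?_⟩
      · have := (ha₀ f).1 (ramp_eq_zero half_pos' h0.le)
        rw [this, Set.Icc.coe_zero] at h2
        apply Subtype.ext
        rw [Set.Icc.coe_zero]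
        linarith
      · rw [h0] at h
        exact absurd h (not_le.2 half_lt_one')
      · have := (ha₀ f).2.2
        rw [h2, h3, ← mul_sub, abs_mul, abs_two] at this
        rw [pow_succ]
        linarith
    · have hfc : half ≤ f c := by
        by_contra! hlt
        have h2 := coe_ramp_zero_half hlt.le
        rw [h₀, hhigh f h, Set.Icc.coe_one] at h2
        have h3 : (f c : ℝ) < half := hlt
        linarith
      have h2 := coe_ramp_half_one hfc
      rw [h₁] at h2
      have h3 : (((ramp half 1 half_lt_one' • φ) f : unitInterval) : ℝ) = 2 * φ f - 1 :=
        coe_ramp_half_one h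
      refine ⟨fun h0 => ?_, fun h0 => ?_, ?_⟩
      · rw [h0] at h
        exact absurd h (not_le.2 half_pos')
      · have := (ha₁ f).2.1 (ramp_eq_one half_lt_one' h0.ge)
        rw [this, Set.Icc.coe_one] at h2
        apply Subtype.ext
        rw [Set.Icc.coe_one]
        linarith
      · have := (ha₁ f).2.2
        rw [h2, h3, sub_sub_sub_cancel_right, ← mul_sub, abs_mul, abs_two] at this
        rw [pow_succ]
        linarith

theorem evalUPos_surjective (hA : IsCauchyComplete A) (hS : IsStackable A) :
    Function.Surjective (evalUPos A) := by
  intro φ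
  choose s hs using fun n => exists_eval_approx hA.1 hS n φ
  replace hs : ∀ n f, |(f (s n) : ℝ) - φ f| ≤ (1 / 2) ^ n := fun n f => (hs n f).2.2
  have hsmall : ∀ δ : ℝ, 0 < δ → ∃ N, ∀ n ≥ N, ∀ f, |(f (s n) : ℝ) - φ f| ≤ δ := by
    intro δ hδ
    obtain ⟨N, hN⟩ := exists_pow_lt_of_lt_one hδ (one_half_lt_one (α := ℝ))
    exact ⟨N, fun n hn f => (hs n f).trans
      ((pow_le_pow_of_le_one (by norm_num) (by norm_num) hn).trans hN.le)⟩
  -- The approximants are Cauchy because maps into `[0,1]` detect `≤_r`.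
  obtain ⟨a, ha⟩ := hA.2 s (fun ε hε => by
    obtain ⟨r, hr0, hr⟩ := exists_between hε
    have hr0' : (0 : ℝ) < r := hr0
    obtain ⟨N, hN⟩ := hsmall (r / 2) (half_pos hr0')
    have key : ∀ m ≥ N, ∀ n ≥ N, LeR r (s m) (s n) := fun m hm n hn =>
      leR_of_forall_hom hA.1 hS.1 fun f => by
        linarith [(abs_le.1 (hN m hm f)).2, (abs_le.1 (hN n hn f)).1]
    exact ⟨N, fun m hm n hn => uDist_lt_of_leR hr (key m hm n hn) (key n hn m hm)⟩)
  have happrox : ∀ f : UPosetHom A unitInterval, ∀ ε : unitInterval, 0 < ε →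
      |(f a : ℝ) - φ f| ≤ ε + ε := by
    intro f ε hε
    obtain ⟨N, hN⟩ := ha ε hε
    obtain ⟨M, hM⟩ := hsmall ε hε
    obtain ⟨h1, h2⟩ := leR_of_uDist_lt (hN (max N M) (le_max_left _ _))
    have h1 := leR_unitInterval.1 (f.map_leR h1)
    have h2 := leR_unitInterval.1 (f.map_leR h2)
    have h3 := abs_le.1 (hM (max N M) (le_max_right _ _) f)
    rw [abs_le]
    constructor <;> linarith
  refine ⟨a, DFunLike.ext _ _ fun f => ?_⟩
  change f a = φ f
  by_contra hne
  have hpos : (0 : ℝ) < |(f a : ℝ) - φ f| :=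
    abs_pos.2 (sub_ne_zero.2 fun h => hne (Subtype.ext h))
  have hle : |(f a : ℝ) - φ f| ≤ 1 := by
    rw [abs_le]
    constructor <;> linarith [(f a).2.1, (f a).2.2, (φ f).2.1, (φ f).2.2]
  -- A third of the discrepancy `d` gives `d ≤ 2d/3`.
  have := happrox f ⟨|(f a : ℝ) - φ f| / 3, by positivity, by linarith⟩
    (show (0 : ℝ) < |(f a : ℝ) - φ f| / 3 by positivity)
  change |(f a : ℝ) - φ f| ≤ |(f a : ℝ) - φ f| / 3 + |(f a : ℝ) - φ f| / 3 at this
  linarith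

/-- Evaluation as an order isomorphism, for a complete stackable `U`-poset. -/
noncomputable def evalUPosIso (hA : IsCauchyComplete A) (hS : IsStackable A) :
    A ≃o CompleteLatticeHom (UPosetHom A unitInterval) unitInterval :=
  RelIso.ofSurjective
    (OrderEmbedding.ofMapLEIff (evalUPos A) fun _ _ => evalUPos_le_iff hA.1 hS.1)
    (evalUPos_surjective hA hS)

end

/-! ### The dual equivalence -/

/-- An order isomorphism given by an equivariant map is an isomorphism of `U`-posets. -/
def UPos.isoMk {A B : UPos.{u}} (f : UPosetHom A B) (e : A ≃o B) (h : ∀ a, e a = f a) : A ≅ B where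
  hom := ConcreteCategory.ofHom (C := UPos.{u}) f
  inv := ConcreteCategory.ofHom (C := UPos.{u})
    { toFun := e.symm
      monotone' := e.symm.monotone
      map_smul' := fun w b => e.injective (by
        obtain ⟨a, rfl⟩ := e.surjective b
        rw [e.apply_symm_apply, e.symm_apply_apply, h, h, f.map_smul]) }
  hom_inv_id := UPosetHom.ext fun a => by
    change e.symm (f a) = a
    rw [← h, e.symm_apply_apply]
  inv_hom_id := UPosetHom.ext fun b => by
    change f (e.symm b) = b
    rw [← h, e.apply_symm_apply]

theorem isCompleteStackable_homOfLat (X : CDLat.{u}ᵒᵖ) :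
    isCompleteStackable ((isCompletelyDistrib.ι.op ⋙ homOfLat).obj X) :=
  ⟨isCauchyComplete_hom _, isStackable_hom _⟩

theorem isCompletelyDistrib_homOfUPos (A : CStUPos.{u}ᵒᵖ) :
    isCompletelyDistrib ((isCompleteStackable.ι.op ⋙ homOfUPos).obj A) :=
  completelyDistrib_hom _

/-- The functor `CDLat(-, [0,1])`. -/
noncomputable def homFunctorCDLat : CDLat.{u}ᵒᵖ ⥤ CStUPos.{u} :=
  isCompleteStackable.lift (isCompletelyDistrib.ι.op ⋙ homOfLat) isCompleteStackable_homOfLat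

/-- The functor `UPos(-, [0,1])`. -/
noncomputable def homFunctorCStUPos : CStUPos.{u}ᵒᵖ ⥤ CDLat.{u} :=
  isCompletelyDistrib.lift (isCompleteStackable.ι.op ⋙ homOfUPos) isCompletelyDistrib_homOfUPos

/-- Evaluation as an isomorphism of completely distributive lattices. -/
noncomputable def evalCDLatIso (X : CDLat.{u}) :
    X ≅ homFunctorCStUPos.obj (op (homFunctorCDLat.obj (op X))) :=
  isCompletelyDistrib.isoMk (CompleteLat.Iso.mk (evalLatIso X.property))

/-- Evaluation as an equivariant map. -/
noncomputable def evalUPosHom (A : Type*) [UPoset A] :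
    UPosetHom A (CompleteLatticeHom (UPosetHom A unitInterval) unitInterval) where
  toFun := evalUPos A
  monotone' _ _ h f := f.mono h
  map_smul' w a := DFunLike.ext _ _ fun f => f.map_smul w a

/-- Evaluation as an isomorphism of complete stackable `U`-posets. -/
noncomputable def evalCStUPosIso (A : CStUPos.{u}) :
    A ≅ homFunctorCDLat.obj (op (homFunctorCStUPos.obj (op A))) :=
  isCompleteStackable.isoMk (UPos.isoMk
    (B := homOfLat.obj (op (homOfUPos.obj (op A.obj))))
    (evalUPosHom A.obj)
    (evalUPosIso A.property.1 A.property.2) fun _ => rfl)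

/-- The unit of the duality. -/
noncomputable def dualityUnit :
    𝟭 CDLat.{u}ᵒᵖ ≅ homFunctorCDLat ⋙ homFunctorCStUPos.rightOp :=
  -- Evaluation is natural by definition, but passing to the opposite category reverses it, so the
  -- unit is its inverse.
  (NatIso.ofComponents (F := homFunctorCDLat ⋙ homFunctorCStUPos.rightOp) (G := 𝟭 CDLat.{u}ᵒᵖ)
    (fun X => (evalCDLatIso X.unop).op) (by
      intro X Y f
      rfl)).symm

/-- The counit of the duality. -/
noncomputable def dualityCounit :
    homFunctorCStUPos.rightOp ⋙ homFunctorCDLat ≅ 𝟭 CStUPos.{u} :=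
  (NatIso.ofComponents (F := 𝟭 CStUPos.{u}) (G := homFunctorCStUPos.rightOp ⋙ homFunctorCDLat)
    (fun A => evalCStUPosIso A) (by
      intro A B f
      rfl)).symm

/-- For the inverses, which are plain evaluations, the triangle holds definitionally: evaluating at
`f` and then restricting along evaluation returns `f`. -/
theorem duality_triangle (X : CDLat.{u}ᵒᵖ) :
    homFunctorCDLat.map (dualityUnit.hom.app X) ≫ dualityCounit.hom.app (homFunctorCDLat.obj X) =
      𝟙 (homFunctorCDLat.obj X) := by
  have h : dualityCounit.inv.app (homFunctorCDLat.obj X) ≫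
      homFunctorCDLat.map (dualityUnit.inv.app X) = 𝟙 (homFunctorCDLat.obj X) := rfl
  simpa [h] using Iso.inv_eq_inv
    (homFunctorCDLat.mapIso (dualityUnit.app X) ≪≫ dualityCounit.app (homFunctorCDLat.obj X))
    (Iso.refl _)

end UPosetDuality

theorem mainTheorem2 :
    ∃ (hF : ∀ X : CDLat.{u}ᵒᵖ,
          isCompleteStackable ((isCompletelyDistrib.ι.op ⋙ homOfLat).obj X))
      (hG : ∀ A : CStUPos.{u}ᵒᵖ,
          isCompletelyDistrib ((isCompleteStackable.ι.op ⋙ homOfUPos).obj A)),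
      let F : CDLat.{u}ᵒᵖ ⥤ CStUPos.{u} :=
        isCompleteStackable.lift (isCompletelyDistrib.ι.op ⋙ homOfLat) hF
      let G : CStUPos.{u}ᵒᵖ ⥤ CDLat.{u} :=
        isCompletelyDistrib.lift (isCompleteStackable.ι.op ⋙ homOfUPos) hG
      ∃ (e : CDLat.{u}ᵒᵖ ≌ CStUPos.{u})
        (unit : 𝟭 CDLat.{u}ᵒᵖ ≅ F ⋙ G.rightOp)
        (counit : G.rightOp ⋙ F ≅ 𝟭 CStUPos.{u})
        (triangle : ∀ X : CDLat.{u}ᵒᵖ,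
          F.map (unit.hom.app X) ≫ counit.hom.app (F.obj X) = 𝟙 (F.obj X)),
        e = Equivalence.mk' F G.rightOp unit counit triangle ∧
        (∀ (X : CDLat.{u}) (x : X.obj),
          ConcreteCategory.hom (unit.inv.app (op X)).unop.hom x = evalLat X.obj x) ∧
        (∀ (A : CStUPos.{u}) (a : A.obj),
          ConcreteCategory.hom (counit.inv.app A).hom a = evalUPos A.obj a) :=
  ⟨isCompleteStackable_homOfLat, isCompletelyDistrib_homOfUPos, _, dualityUnit, dualityCounit,
    duality_triangle, rfl, fun _ _ => rfl, fun _ _ => rfl⟩
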